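/- Let $\mathscr X\subseteq\mathbb R^n$ and $\Xi\subseteq\mathbb R^m$, let $\|\cdot\|$ be a norm on $\mathbb R^m$, and let $f:\mathbb R^n\to\overline{\mathbb R}$ and $g:\mathbb R^n\times\mathbb R^m\to\overline{\mathbb R}$ be extended-real-valued functions such that $g(x,\cdot)$ is Borel measurable for every $x\in\mathscr X$. Let $\Gamma^N=\{\hat w_1,\dots,\hat w_N\}$ be a family of $N$ data points in $\Xi$ (repetitions allowed), partitioned into $K$ nonempty clusters $\Gamma_1,\dots,\Gamma_K$, and suppose that $g(x,\hat w)>-\infty$ for all $x\in\mathscr X$ and $\hat w\in\Gamma^N$. Write $\hat{\mathbb P}_k=\frac1{|\Gamma_k|}\sum_{\hat w\in\Gamma_k}\delta_{\hat w}$. For $\theta_k>0$ let $\mathscr W_k$ be the set of all Borel probability measures $\mathbb Q$ supported on $\Xi$ with $d_W(\mathbb Q,\hat{\mathbb P}_k)\le\theta_k$, where $d_W(\mathbb Q,\mathbb P)=\inf_\pi\int\|u-v\|\,d\pi(u,v)$ over all couplings $\pi$ of $\mathbb Q$ and $\mathbb P$. Let $$\mathscr B(\Gamma^N)=\Big\{\sum_{k=1}^K\tfrac{|\Gamma_k|}{N}\mathbb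 Q_k:\ \mathbb Q_k\in\mathscr W_k\Big\}.$$ An expectation whose positive and negative parts are both infinite is read as $-\infty$ (so that it does not count in a supremum), and $\infty-\infty=\infty$ in the objective of the minimization problem (P) below. Then: 1. For every $x\in\mathscr X$, $$\sup_{\mathbb Q\in\mathscr B(\Gamma^N)}\mathbb E_{\mathbb Q}[g(x,w)]=\sum_{k=1}^K\frac{|\Gamma_k|}{N}\sup_{\mathbb Q_k\in\mathscr W_k}\mathbb E_{\mathbb Q_k}[g(x,w)].$$ 2. The problem $$\text{(P)}\qquad \inf_{x\in\mathscr X}\Big\{f(x)+\sup_{\mathbb Q\in\mathscr B(\Gamma^N)}\mathbb E_{\mathbb Q}[g(x,w)]\Big\}$$ is equivalent to the problem (R) of minimizing $$f(x)+\sum_{k=1}^K\frac{|\Gamma_k|}{N}\Big[\lambda_k\theta_k+\sum_{\hat w\in\Gamma_k}\frac{\alpha_{\hat w}}{|\Gamma_k|}\Big]$$ over $x\in\mathscr X$, $\lambda\in[0,\infty)^K$ and $\alpha\in\mathbb R^N$ subject to $$\alpha_{\hat w}\ge\sup_{w\in\Xi}\{g(x,w)-\lambda_k\|\hat w-w\|\}\qquad\text{for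 all }k\text{ and }\hat w\in\Gamma_k ,$$ in the following sense. The optimal values of (P) and (R) coincide. For each fixed $x\in\mathscr X$ the infimum of the objective of (R) over the feasible $(\lambda,\alpha)$ equals the objective of (P) at $x$, and it is attained if the worst-case expectation at $x$ is less than $+\infty$. A point $x$ is a minimizer of (P) with objective value less than $+\infty$ if and only if there are $\lambda,\alpha$ such that $(x,\lambda,\alpha)$ is a minimizer of (R) with objective value less than $+\infty$. -/

import Mathlib

open MeasureTheory
open scoped ENNReal Pointwise

noncomputable section

namespace BNWDRO

section Wasserstein

variable {E : Type*} [NormedAddCommGroup E] [MeasurableSpace E]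

/-- The Borel probability measures supported on `Ξ`. -/
def probOn (Ξ : Set E) : Set (Measure E) :=
  {Q | IsProbabilityMeasure Q ∧ ∀ᵐ w ∂Q, w ∈ Ξ}

/-- The couplings of `Q` and `P`. -/
def couplings (Q P : Measure E) : Set (Measure (E × E)) :=
  {π | π.map Prod.fst = Q ∧ π.map Prod.snd = P}

/-- The Wasserstein distance (of order one) for the norm of `E`. If `Q` and `P` are supported on
`Ξ`, every coupling of them is automatically supported on `Ξ × Ξ`. -/
def wassersteinDist (Q P : Measure E) : ℝ≥0∞ :=
  ⨅ π ∈ couplings Q P, ∫⁻ p, ‖p.1 - p.2‖ₑ ∂π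

/-- The Wasserstein ball of radius `r` around `P` in the probability measures on `Ξ`. -/
def wassersteinBall (Ξ : Set E) (r : ℝ) (P : Measure E) : Set (Measure E) :=
  {Q | Q ∈ probOn Ξ ∧ wassersteinDist Q P ≤ ENNReal.ofReal r}

/-- Expectation of an extended-real function: integral of the positive part minus integral of the
negative part. In `EReal` one has `⊤ - ⊤ = ⊥`, so an undefined expectation counts as `⊥`, that is,
it never contributes to a supremum. -/
def expect (Q : Measure E) (h : E → EReal) : EReal :=
  ((∫⁻ w, (h w).toENNReal ∂Q : ℝ≥0∞) : EReal) - ((∫⁻ w, (-(h w)).toENNReal ∂Q : ℝ≥0∞) : EReal)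

/-- The worst-case expectation of `h` over a set `S` of measures. -/
def worstCase (S : Set (Measure E)) (h : E → EReal) : EReal :=
  ⨆ Q ∈ S, expect Q h

end Wasserstein

/-- Addition of extended reals with the convention of minimization problems, `∞ - ∞ = ∞`
(`EReal` addition has `⊤ + ⊥ = ⊥`); in all other cases it is the usual sum. -/
def minAdd (a b : EReal) : EReal := -(-a + -b)

/-- The (indices of the) data in the cluster with label `k`. -/
def cluster {N K : ℕ} (z : Fin N → Fin K) (k : Fin K) : Finset (Fin N) :=
  Finset.univ.filter fun l => z l = k

section Problem

variable {E : Type*} [NormedAddCommGroup E] [MeasurableSpace E] {n N K : ℕ}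

/-- The empirical distribution of the cluster with label `k`. -/
def localEmpirical (data : Fin N → E) (z : Fin N → Fin K) (k : Fin K) : Measure E :=
  ((cluster z k).card : ℝ≥0∞)⁻¹ • ∑ l ∈ cluster z k, Measure.dirac (data l)

/-- The local Wasserstein ball of the cluster with label `k`. -/
def localBall (Ξ : Set E) (data : Fin N → E) (z : Fin N → Fin K) (θ : Fin K → ℝ) (k : Fin K) :
    Set (Measure E) :=
  wassersteinBall Ξ (θ k) (localEmpirical data z k)

/-- The ambiguity set: the weighted Minkowski sum of the local Wasserstein balls. -/
def ambiguitySet (Ξ : Set E) (data : Fin N → E) (z : Fin N → Fin K) (θ : Fin K → ℝ) :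
    Set (Measure E) :=
  ∑ k, (((cluster z k).card : ℝ≥0∞) / (N : ℝ≥0∞)) • localBall Ξ data z θ k

/-- The objective function of the distributionally robust problem. -/
def robustObjective (Ξ : Set E) (f : (Fin n → ℝ) → EReal) (g : (Fin n → ℝ) → E → EReal)
    (data : Fin N → E) (z : Fin N → Fin K) (θ : Fin K → ℝ) (x : Fin n → ℝ) : EReal :=
  minAdd (f x) (worstCase (ambiguitySet Ξ data z θ) (g x))

/-- The objective function of the reformulation, at `(x, lam, α)`. -/
def reformObjective (f : (Fin n → ℝ) → EReal) (z : Fin N → Fin K) (θ : Fin K → ℝ)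
    (p : (Fin n → ℝ) × (Fin K → ℝ) × (Fin N → ℝ)) : EReal :=
  f p.1 + ((∑ k, ((cluster z k).card : ℝ) / (N : ℝ) *
    (p.2.1 k * θ k + ∑ l ∈ cluster z k, p.2.2 l / ((cluster z k).card : ℝ)) : ℝ) : EReal)

/-- The feasible set of the reformulation: the triples `(x, lam, α)` with `x` in the feasible
region, `lam ≥ 0`, and `α l ≥ sup_{w ∈ Ξ} (g x w - lam k * ‖data l - w‖)` for every index `l`
in the cluster with label `k`. -/
def reformFeasible (X : Set (Fin n → ℝ)) (Ξ : Set E) (g : (Fin n → ℝ) → E → EReal)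
    (data : Fin N → E) (z : Fin N → Fin K) :
    Set ((Fin n → ℝ) × (Fin K → ℝ) × (Fin N → ℝ)) :=
  {p | p.1 ∈ X ∧ (∀ k, 0 ≤ p.2.1 k) ∧ ∀ k, ∀ l ∈ cluster z k,
    (⨆ w ∈ Ξ, (g p.1 w - ((p.2.1 k * ‖data l - w‖ : ℝ) : EReal))) ≤ ((p.2.2 l : ℝ) : EReal)}

end Problem

end BNWDRO

end

/-! The worst-case expectation over a weighted Minkowski sum of sets of measures is the weighted
sum of the worst cases, because expectations, with an undefined one read as `⊥`, are additive in
the measure (`worstCase_sum_smul`). It remains to dualize the worst case `V` of `h` over one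
Wasserstein ball of radius `r` around the uniform distribution on a finite family of points `d l`.

Weak duality (`worstCase_wassersteinBall_le`): if `h u ≤ lam * ‖d l - u‖ + α l` on `Ξ`, integrate
this against couplings of nearly optimal cost.

Strong duality (`exists_multiplier`) is elementary, and needs neither minimax theorems nor
compactness of the ball. Let `V < ⊤`. As a little mass can be moved to any point of `Ξ`, `h` is
`< ⊤` there. Every choice of points `a l ∈ Ξ` with `h (a l)` real is a transport plan with a cost
`C a` (the mean of `‖a l - d l‖`) and a value `G a` (the mean of `h (a l)`), and mixtures of two
such plans with cost at most `r` have value at most `V`. Such mixtures alone force the existence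
of a slope `lam ≥ 0` with `G a ≤ V + lam * (C a - r)` for all `a` (`exists_slope`), since
`C d = 0 < r`. The resulting bound is a sum over `l` of terms in which only `a l` occurs, so the
suprema over the `a l` can be taken separately (`exists_upperBounds_sum_le`), and they are the
`α l`.

Hence, for each decision, the robust objective is a lower bound for the objective of the
reformulation (`robustObjective_le_reformObjective`), and it is attained unless it is `⊤`
(`exists_reformObjective_eq`); the claims on optimal values and minimizers follow formally. -/

noncomputable section

namespace BNWDRO

/-! ### Sums of extended reals -/

section EReal

theorem coe_finsetSum {ι : Type*} (s : Finset ι) (f : ι → ℝ) :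
    ((∑ i ∈ s, f i : ℝ) : EReal) = ∑ i ∈ s, (f i : EReal) :=
  map_sum (⟨⟨Real.toEReal, EReal.coe_zero⟩, EReal.coe_add⟩ : ℝ →+ EReal) f s

theorem sum_ne_bot {ι : Type*} {s : Finset ι} {f : ι → EReal} (hf : ∀ i ∈ s, f i ≠ ⊥) :
    ∑ i ∈ s, f i ≠ ⊥ := by
  refine Finset.sum_induction _ (· ≠ (⊥ : EReal)) (fun a b ha hb => ?_) (by simp) hf
  simp [EReal.add_eq_bot_iff, ha, hb]

theorem coe_mul_ne_bot {c : ℝ} (hc : 0 ≤ c) {a : EReal} (ha : a ≠ ⊥) : (c : EReal) * a ≠ ⊥ := by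
  rw [EReal.mul_ne_bot]
  refine ⟨Or.inl (EReal.coe_ne_bot c), Or.inr ha, Or.inl (EReal.coe_ne_top c), Or.inl ?_⟩
  exact_mod_cast hc

end EReal

/-! ### Expectations of extended-real functions -/

section Expect

variable {E : Type*} [MeasurableSpace E]

/-- Since `⊤ - ⊤ = ⊥`, an expectation is `⊥` exactly when the negative part has infinite integral,
whatever the positive part does. -/
theorem expect_ne_bot_iff {Q : Measure E} {h : E → EReal} :
    expect Q h ≠ ⊥ ↔ ∫⁻ w, (-(h w)).toENNReal ∂Q ≠ ⊤ := by
  unfold expect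
  generalize ∫⁻ w, (h w).toENNReal ∂Q = a
  generalize ∫⁻ w, (-(h w)).toENNReal ∂Q = b
  induction b with
  | top => simp
  | coe b =>
    induction a with
    | top => simp [EReal.coe_nnreal_eq_coe_real]
    | coe a =>
      rw [EReal.coe_nnreal_eq_coe_real, EReal.coe_nnreal_eq_coe_real, ← EReal.coe_sub]
      simp only [ne_eq, EReal.coe_ne_bot, not_false_eq_true, ENNReal.coe_ne_top]

theorem expect_congr {Q : Measure E} {h h' : E → EReal} (hh : h =ᵐ[Q] h') :
    expect Q h = expect Q h' := by
  unfold expect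
  congr 2
  · exact lintegral_congr_ae (hh.mono fun w hw => by simp only [hw])
  · exact lintegral_congr_ae (hh.mono fun w hw => by simp only [hw])

theorem expect_coe {Q : Measure E} {h : E → ℝ} (hi : Integrable h Q) :
    expect Q (fun w => (h w : EReal)) = ((∫ w, h w ∂Q : ℝ) : EReal) := by
  rw [integral_eq_lintegral_pos_part_sub_lintegral_neg_part hi]
  unfold expect
  have h1 : ∫⁻ w, ENNReal.ofReal (h w) ∂Q ≠ ⊤ := hi.lintegral_lt_top.ne
  have h2 : ∫⁻ w, ENNReal.ofReal (-h w) ∂Q ≠ ⊤ := hi.neg.lintegral_lt_top.ne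
  simp only [← EReal.coe_neg, EReal.toENNReal_of_ne_top (EReal.coe_ne_top _), EReal.toReal_coe]
  rw [EReal.coe_sub, EReal.coe_ennreal_toReal h1, EReal.coe_ennreal_toReal h2]

/-- An integrable real function that dominates `h` almost everywhere bounds its expectation. If the
negative part of `h` has infinite integral, the expectation is `⊥`; otherwise `h` is almost
everywhere real and integrable. -/
theorem expect_le_integral {Q : Measure E} {h : E → EReal} (hm : Measurable h) {T : E → ℝ}
    (hT : Integrable T Q) (hle : ∀ᵐ w ∂Q, h w ≤ (T w : EReal)) :
    expect Q h ≤ ((∫ w, T w ∂Q : ℝ) : EReal) := by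
  by_cases hb : expect Q h = ⊥
  · simp [hb]
  have hneg := expect_ne_bot_iff.1 hb
  have hnb : ∀ᵐ w ∂Q, (-(h w)).toENNReal < ⊤ :=
    ae_lt_top (by fun_prop) hneg
  have hreal : h =ᵐ[Q] fun w => ((h w).toReal : EReal) := by
    filter_upwards [hle, hnb] with w h1 h2
    refine (EReal.coe_toReal (ne_top_of_le_ne_top (EReal.coe_ne_top _) h1) ?_).symm
    rintro h3
    simp [h3] at h2
  have hint : Integrable (fun w => (h w).toReal) Q := by
    refine ⟨hm.ereal_toReal.aestronglyMeasurable, ?_⟩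
    have hdom : ∀ᵐ w ∂Q, ‖(h w).toReal‖ₑ ≤ ‖T w‖ₑ + (-(h w)).toENNReal := by
      filter_upwards [hle, hreal] with w h1 h2
      rw [h2] at h1 ⊢
      generalize (h w).toReal = r at *
      rw [EReal.coe_le_coe_iff] at h1
      rw [← EReal.coe_neg, EReal.toENNReal_of_ne_top (EReal.coe_ne_top _), EReal.toReal_coe,
        EReal.toReal_coe]
      rcases le_total 0 r with h0 | h0
      · refine le_add_right ?_
        rw [Real.enorm_eq_ofReal h0, Real.enorm_eq_ofReal (h0.trans h1)]
        exact ENNReal.ofReal_le_ofReal h1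
      · refine le_add_left ?_
        rw [← enorm_neg, Real.enorm_eq_ofReal (by linarith)]
    refine (lintegral_mono_ae hdom).trans_lt ?_
    rw [lintegral_add_left' hT.aestronglyMeasurable.enorm]
    exact ENNReal.add_lt_top.2 ⟨hT.2, lt_top_iff_ne_top.2 hneg⟩
  rw [expect_congr hreal, expect_coe hint, EReal.coe_le_coe_iff]
  refine integral_mono_ae hint hT ?_
  filter_upwards [hle, hreal] with w h1 h2
  rwa [h2, EReal.coe_le_coe_iff] at h1

theorem expect_map {F : Type*} [MeasurableSpace F] {π : Measure F}
    {T : F → E} (hT : Measurable T) {h : E → EReal} (hm : Measurable h) :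
    expect (π.map T) h = expect π (h ∘ T) := by
  unfold expect
  rw [lintegral_map (by fun_prop) hT, lintegral_map (by fun_prop) hT]
  rfl

/-- Additivity in the measure holds without integrability assumptions: if one of the negative parts
has infinite integral, both sides are `⊥`, by `⊤ - ⊤ = ⊥` and `⊤ + ⊥ = ⊥`. -/
theorem expect_add (μ ν : Measure E) (h : E → EReal) :
    expect (μ + ν) h = expect μ h + expect ν h := by
  unfold expect
  rw [lintegral_add_measure, lintegral_add_measure]
  generalize ∫⁻ w, (h w).toENNReal ∂μ = a
  generalize ∫⁻ w, (h w).toENNReal ∂ν = b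
  generalize ∫⁻ w, (-(h w)).toENNReal ∂μ = c
  generalize ∫⁻ w, (-(h w)).toENNReal ∂ν = d
  rw [EReal.coe_ennreal_add, EReal.coe_ennreal_add, sub_eq_add_neg, sub_eq_add_neg, sub_eq_add_neg,
    EReal.neg_add (Or.inl (EReal.coe_ennreal_ne_bot c)) (Or.inr (EReal.coe_ennreal_ne_bot d)),
    sub_eq_add_neg, add_add_add_comm]

theorem expect_smul {μ : Measure E} {h : E → EReal} {c : ℝ≥0∞} (hc : c ≠ ⊤) :
    expect (c • μ) h = (c.toReal : EReal) * expect μ h := by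
  unfold expect
  rw [lintegral_smul_measure, lintegral_smul_measure, smul_eq_mul, smul_eq_mul,
    EReal.coe_ennreal_toReal hc, EReal.coe_ennreal_mul, EReal.coe_ennreal_mul]
  exact (EReal.mul_sub_of_nonneg_of_ne_top (EReal.coe_ennreal_nonneg c)
    (by simpa using hc)).symm

theorem expect_zero {h : E → EReal} : expect (0 : Measure E) h = 0 := by
  simp [expect]

theorem expect_sum_smul {ι : Type*} (s : Finset ι) (μ : ι → Measure E) (h : E → EReal)
    {c : ι → ℝ≥0∞} (hc : ∀ i ∈ s, c i ≠ ⊤) :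
    expect (∑ i ∈ s, c i • μ i) h = ∑ i ∈ s, ((c i).toReal : EReal) * expect (μ i) h := by
  classical
  induction s using Finset.induction_on with
  | empty => simp [expect_zero]
  | insert i s hi ih =>
    rw [Finset.sum_insert hi, Finset.sum_insert hi, expect_add,
      expect_smul (hc i (Finset.mem_insert_self i s)),
      ih fun j hj => hc j (Finset.mem_insert_of_mem hj)]

theorem expect_dirac [MeasurableSingletonClass E] (a : E) (h : E → EReal) :
    expect (Measure.dirac a) h = h a := by
  unfold expect
  rw [lintegral_dirac, lintegral_dirac]
  rcases le_total 0 (h a) with h0 | h0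
  · have h1 : -h a ≤ 0 := by simpa using h0
    simp [EReal.coe_toENNReal h0, EReal.toENNReal_of_nonpos h1]
  · have h1 : 0 ≤ -h a := by simpa using h0
    simp [EReal.coe_toENNReal h1, EReal.toENNReal_of_nonpos h0]

end Expect

/-! ### Empirical distributions -/

section Empirical

variable {ι E : Type*} [MeasurableSpace E]

/-- The uniform distribution on the family `d` restricted to the indices in `s` (with
multiplicities). -/
def empirical (s : Finset ι) (d : ι → E) : Measure E :=
  (s.card : ℝ≥0∞)⁻¹ • ∑ l ∈ s, Measure.dirac (d l)

theorem empirical_eq_sum (s : Finset ι) (d : ι → E) :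
    empirical s d = ∑ l ∈ s, (s.card : ℝ≥0∞)⁻¹ • Measure.dirac (d l) :=
  Finset.smul_sum

theorem isProbabilityMeasure_empirical {s : Finset ι} (hs : s.Nonempty) (d : ι → E) :
    IsProbabilityMeasure (empirical s d) := by
  refine ⟨?_⟩
  simp only [empirical, Measure.smul_apply, Measure.finsetSum_apply, measure_univ,
    Finset.sum_const, nsmul_eq_mul, mul_one, smul_eq_mul]
  exact ENNReal.inv_mul_cancel (by simpa using hs.ne_empty) (ENNReal.natCast_ne_top _)

theorem map_empirical {F : Type*} [MeasurableSpace F] (s : Finset ι) (d : ι → E) {T : E → F}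
    (hT : Measurable T) : (empirical s d).map T = empirical s (T ∘ d) := by
  rw [empirical, Measure.map_smul, ← Measure.mapₗ_apply_of_measurable hT, map_sum]
  simp only [Measure.mapₗ_apply_of_measurable hT, Measure.map_dirac' hT]
  rfl

theorem lintegral_empirical [MeasurableSingletonClass E] (s : Finset ι) (d : ι → E)
    (F : E → ℝ≥0∞) :
    ∫⁻ w, F w ∂(empirical s d) = (s.card : ℝ≥0∞)⁻¹ * ∑ l ∈ s, F (d l) := by
  simp [empirical]

theorem integrable_empirical [MeasurableSingletonClass E] {s : Finset ι} (hs : s.Nonempty)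
    (d : ι → E) (F : E → ℝ) : Integrable F (empirical s d) := by
  refine Integrable.smul_measure ?_ (by simpa using hs.ne_empty)
  exact integrable_finsetSum_measure.2 fun l _ => integrable_dirac (by simp)

theorem integral_empirical [MeasurableSingletonClass E] (s : Finset ι) (d : ι → E)
    (F : E → ℝ) :
    ∫ w, F w ∂(empirical s d) = (s.card : ℝ)⁻¹ * ∑ l ∈ s, F (d l) := by
  rw [empirical, integral_smul_measure,
    integral_finsetSum_measure fun l _ => integrable_dirac (by simp)]
  simp

theorem ae_empirical [MeasurableSingletonClass E] {s : Finset ι} {d : ι → E} {p : E → Prop}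
    (hp : ∀ l ∈ s, p (d l)) : ∀ᵐ w ∂(empirical s d), p w := by
  refine Measure.ae_smul_measure ?_ _
  rw [← Measure.sum_coe_finset, Measure.ae_sum_iff]
  rintro ⟨l, hl⟩
  rw [ae_dirac_eq]
  exact hp l hl

theorem expect_empirical [MeasurableSingletonClass E] (s : Finset ι) (d : ι → E)
    (h : E → EReal) :
    expect (empirical s d) h = ∑ l ∈ s, (((s.card : ℝ)⁻¹ : ℝ) : EReal) * h (d l) := by
  rcases s.eq_empty_or_nonempty with rfl | hs
  · simp [empirical, expect_zero]
  rw [empirical_eq_sum, expect_sum_smul _ _ _ fun _ _ => by simpa using hs.ne_empty]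
  simp [expect_dirac]

theorem expect_empirical_ne_bot [MeasurableSingletonClass E] (s : Finset ι) {d : ι → E}
    {h : E → EReal} (hd : ∀ l ∈ s, h (d l) ≠ ⊥) : expect (empirical s d) h ≠ ⊥ := by
  rw [expect_empirical]
  exact sum_ne_bot fun l hl => coe_mul_ne_bot (by positivity) (hd l hl)

theorem expect_empirical_coe [MeasurableSingletonClass E] (s : Finset ι) {d : ι → E}
    {h : E → EReal} (hd : ∀ l ∈ s, h (d l) ≠ ⊥) (hd' : ∀ l ∈ s, h (d l) ≠ ⊤) :
    expect (empirical s d) h =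
      (((s.card : ℝ)⁻¹ * ∑ l ∈ s, (h (d l)).toReal : ℝ) : EReal) := by
  rw [expect_empirical, Finset.mul_sum, coe_finsetSum]
  refine Finset.sum_congr rfl fun l hl => ?_
  rw [EReal.coe_mul, EReal.coe_toReal (hd' l hl) (hd l hl)]

theorem expect_empirical_eq_top [MeasurableSingletonClass E] {s : Finset ι} {d : ι → E}
    {h : E → EReal} (hd : ∀ l ∈ s, h (d l) ≠ ⊥) {i : ι} (hi : i ∈ s) (hdi : h (d i) = ⊤) :
    expect (empirical s d) h = ⊤ := by
  classical
  have hc : (0 : ℝ) < (s.card : ℝ)⁻¹ := by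
    have := Finset.card_pos.2 ⟨i, hi⟩
    positivity
  rw [expect_empirical, ← Finset.add_sum_erase s _ hi, hdi,
    EReal.coe_mul_top_of_pos hc]
  exact EReal.top_add_of_ne_bot <| sum_ne_bot fun l hl =>
    coe_mul_ne_bot hc.le (hd l (Finset.mem_of_mem_erase hl))

end Empirical

/-! ### Weak duality -/

section Duality

variable {ι E : Type*} [NormedAddCommGroup E] [NormedSpace ℝ E] [FiniteDimensional ℝ E]
  [MeasurableSpace E] [BorelSpace E]

/-- The estimate behind weak duality, for one coupling: integrate
`h u ≤ lam * ‖u - v‖ + A v` against it, where `A` is a function with `A (d l) ≤ α l`. -/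
theorem expect_le_of_coupling {s : Finset ι} (hs : s.Nonempty)
    {d : ι → E} {Ξ : Set E} {h : E → EReal} (hm : Measurable h) {lam : ℝ} {α : ι → ℝ}
    (hα : ∀ l ∈ s, ∀ w ∈ Ξ, h w ≤ ((lam * ‖d l - w‖ + α l : ℝ) : EReal))
    {Q : Measure E} (hQ : Q ∈ probOn Ξ) {π : Measure (E × E)}
    (hπ : π ∈ couplings Q (empirical s d)) (hc : ∫⁻ p, ‖p.1 - p.2‖ₑ ∂π ≠ ⊤) :
    expect Q h ≤ ((lam * (∫⁻ p, ‖p.1 - p.2‖ₑ ∂π).toReal +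
      (s.card : ℝ)⁻¹ * ∑ l ∈ s, α l : ℝ) : EReal) := by
  classical
  obtain ⟨rfl, hπ2⟩ := hπ
  have hmin : ∀ v ∈ s.image d, ∃ m ∈ s, d m = v ∧ ∀ l ∈ s, d l = v → α m ≤ α l := by
    intro v hv
    obtain ⟨l, hl, hlv⟩ := Finset.mem_image.1 hv
    obtain ⟨m, hm1, hm2⟩ := Finset.exists_min_image (s.filter fun l => d l = v) α
      ⟨l, by simp [hl, hlv]⟩
    rw [Finset.mem_filter] at hm1
    exact ⟨m, hm1.1, hm1.2, fun l hl hlv => hm2 l (by simp [hl, hlv])⟩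
  have : Nonempty ι := ⟨hs.choose⟩
  choose! m hm1 hm2 hm3 using hmin
  -- repeated data points may carry different `α l`, so `A v` is the least `α l` with `d l = v`
  have hA : Measurable fun v => ∑ w ∈ s.image d, if v = w then α (m w) else 0 :=
    Finset.measurable_sum _ fun w _ =>
      Measurable.ite (measurableSet_singleton w) measurable_const measurable_const
  set A : E → ℝ := fun v => ∑ w ∈ s.image d, if v = w then α (m w) else 0 with hAdef
  have hAd : ∀ v ∈ s.image d, A v = α (m v) := fun v hv => by
    simp [hAdef, Finset.sum_ite_eq, -Finset.mem_image, hv]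
  have hAi : Integrable (fun p : E × E => A p.2) π := by
    have := integrable_empirical hs d A
    rw [← hπ2] at this
    exact this.comp_measurable measurable_snd
  have hAint : ∫ p, A p.2 ∂π ≤ (s.card : ℝ)⁻¹ * ∑ l ∈ s, α l := by
    rw [← integral_map (f := A) measurable_snd.aemeasurable hA.aestronglyMeasurable, hπ2,
      integral_empirical]
    gcongr with l hl
    rw [hAd _ (Finset.mem_image_of_mem d hl)]
    exact hm3 _ (Finset.mem_image_of_mem d hl) l hl rfl
  have hCi : Integrable (fun p : E × E => ‖p.1 - p.2‖) π := by
    refine ⟨by fun_prop, ?_⟩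
    simpa [HasFiniteIntegral, lt_top_iff_ne_top] using hc
  have hCint : ∫ p, ‖p.1 - p.2‖ ∂π = (∫⁻ p, ‖p.1 - p.2‖ₑ ∂π).toReal :=
    integral_norm_eq_lintegral_enorm (by fun_prop)
  have hfst : ∀ᵐ p ∂π, p.1 ∈ Ξ := ae_of_ae_map measurable_fst.aemeasurable hQ.2
  have hsnd : ∀ᵐ p ∂π, p.2 ∈ s.image d := by
    refine ae_of_ae_map (p := fun v => v ∈ s.image d) measurable_snd.aemeasurable ?_
    rw [hπ2]
    exact ae_empirical fun l hl => Finset.mem_image_of_mem d hl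
  rw [expect_map measurable_fst hm]
  refine (expect_le_integral (T := fun p => lam * ‖p.1 - p.2‖ + A p.2)
    (hm.comp measurable_fst) ((hCi.const_mul lam).add hAi) ?_).trans ?_
  · filter_upwards [hfst, hsnd] with p h1 h2
    have := hα (m p.2) (hm1 _ h2) p.1 h1
    rwa [hm2 _ h2, ← hAd _ h2, norm_sub_rev] at this
  · rw [integral_add (hCi.const_mul lam) hAi, integral_const_mul, hCint]
    exact EReal.coe_le_coe_iff.2 (by gcongr)

/-- Weak duality: feasible multipliers bound the worst-case expectation over a Wasserstein ball
around an empirical distribution. The infimum over couplings need not be attained a priori, whence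
the `ε`. -/
theorem worstCase_wassersteinBall_le {s : Finset ι} (hs : s.Nonempty)
    {d : ι → E} {Ξ : Set E} {h : E → EReal} (hm : Measurable h) {lam : ℝ} (hlam : 0 ≤ lam)
    {α : ι → ℝ} (hα : ∀ l ∈ s, ∀ w ∈ Ξ, h w ≤ ((lam * ‖d l - w‖ + α l : ℝ) : EReal))
    {r : ℝ} (hr : 0 ≤ r) :
    worstCase (wassersteinBall Ξ r (empirical s d)) h ≤
      ((lam * r + (s.card : ℝ)⁻¹ * ∑ l ∈ s, α l : ℝ) : EReal) := by
  refine iSup₂_le fun Q hQ => ?_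
  have key : ∀ ε : ℝ, 0 < ε →
      expect Q h ≤ ((lam * (r + ε) + (s.card : ℝ)⁻¹ * ∑ l ∈ s, α l : ℝ) : EReal) := by
    intro ε hε
    have hlt : wassersteinDist Q (empirical s d) < ENNReal.ofReal (r + ε) :=
      hQ.2.trans_lt ((ENNReal.ofReal_lt_ofReal_iff (by linarith)).2 (by linarith))
    simp only [wassersteinDist, iInf_lt_iff] at hlt
    obtain ⟨π, hπ, hlt⟩ := hlt
    refine (expect_le_of_coupling hs hm hα hQ.1 hπ (ne_top_of_lt hlt)).trans ?_
    refine EReal.coe_le_coe_iff.2 ?_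
    gcongr
    exact ENNReal.toReal_le_of_le_ofReal (by linarith) hlt.le
  by_cases hb : expect Q h = ⊥
  · simp [hb]
  have ht : expect Q h ≠ ⊤ := ne_top_of_le_ne_top (EReal.coe_ne_top _) (key 1 one_pos)
  lift expect Q h to ℝ using ⟨ht, hb⟩ with e
  simp only [EReal.coe_le_coe_iff] at key ⊢
  refine le_of_forall_pos_le_add fun ε hε => ?_
  have := key (ε / (lam + 1)) (by positivity)
  have h2 : lam * (ε / (lam + 1)) ≤ ε := by
    rw [mul_div_assoc', div_le_iff₀ (by positivity)]
    nlinarith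
  linarith

end Duality

/-! ### Separation in the plane, and sums of suprema -/

section Separation

/-- The set of pairs (cost, value) is separated from the quadrant of the pairs with cost at most `r`
and value greater than `v`. In dimension two it is enough to test mixtures of two points, so that no
more than these are needed in `hmix`; the point `a₀` (a Slater point) excludes a vertical line. -/
theorem exists_slope {A : Type*} {C G : A → ℝ} {v r : ℝ} {a₀ : A} (h₀ : C a₀ < r)
    (hmix : ∀ a b, ∀ t : ℝ, 0 ≤ t → t ≤ 1 → (1 - t) * C a + t * C b ≤ r →
      (1 - t) * G a + t * G b ≤ v) :
    ∃ lam : ℝ, 0 ≤ lam ∧ ∀ a, G a ≤ v + lam * (C a - r) := by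
  have hpure : ∀ a, C a ≤ r → G a ≤ v := fun a ha => by
    simpa using hmix a a 0 le_rfl zero_le_one (by simpa using ha)
  set R : Set ℝ := (fun a => (v - G a) / (r - C a)) '' {a | C a < r} with hR
  have hne : R.Nonempty := ⟨_, a₀, h₀, rfl⟩
  have hnn : ∀ y ∈ R, 0 ≤ y := by
    rintro _ ⟨a, ha, rfl⟩
    exact div_nonneg (sub_nonneg.2 (hpure a (le_of_lt ha))) (sub_nonneg.2 (le_of_lt ha))
  refine ⟨sInf R, le_csInf hne hnn, fun b => ?_⟩
  rcases lt_trichotomy (C b) r with hb | hb | hb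
  · have h1 : sInf R ≤ (v - G b) / (r - C b) := csInf_le ⟨0, hnn⟩ ⟨b, hb, rfl⟩
    rw [le_div_iff₀ (by linarith)] at h1
    linarith
  · have := hpure b hb.le
    rw [hb]
    linarith
  · have h1 : (G b - v) / (C b - r) ≤ sInf R := by
      refine le_csInf hne ?_
      rintro _ ⟨a, ha, rfl⟩
      have ha' : C a < r := ha
      have hD : 0 < C b - C a := by linarith
      -- this weight gives the mixture of `a` and `b` cost exactly `r`
      have h1t : 1 - (r - C a) / (C b - C a) = (C b - r) / (C b - C a) := by
        field_simp
        ring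
      have := hmix a b ((r - C a) / (C b - C a)) (div_nonneg (by linarith) hD.le)
        ((div_le_one hD).2 (by linarith)) (by
          rw [h1t]
          apply le_of_eq
          field_simp
          ring)
      rw [h1t, div_mul_eq_mul_div, div_mul_eq_mul_div, ← add_div, div_le_iff₀ hD] at this
      rw [div_le_div_iff₀ (by linarith) (by linarith)]
      linarith
    rw [div_le_iff₀ (by linarith)] at h1
    linarith

/-- If `∑ i, φ i (w i) ≤ B` for every choice of the points `w i`, then also the sum of the suprema
of the `φ i` is at most `B`. -/
theorem exists_upperBounds_sum_le {ι E : Type*} (s : Finset ι) {S : Set E} (hS : S.Nonempty)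
    {φ : ι → E → ℝ} {B : ℝ} (hB : ∀ w : ι → E, (∀ i, w i ∈ S) → ∑ i ∈ s, φ i (w i) ≤ B) :
    ∃ α : ι → ℝ, (∀ i ∈ s, ∀ w ∈ S, φ i w ≤ α i) ∧ ∑ i ∈ s, α i ≤ B := by
  classical
  obtain ⟨w₀, hw₀⟩ := hS
  have hbdd : ∀ i ∈ s, BddAbove (φ i '' S) := by
    intro i hi
    refine ⟨B - ∑ j ∈ s.erase i, φ j w₀, ?_⟩
    rintro _ ⟨w, hw, rfl⟩
    have := hB (Function.update (fun _ => w₀) i w) (fun j => by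
      rcases eq_or_ne j i with rfl | hj
      · simpa using hw
      · simpa [hj] using hw₀)
    rw [← Finset.add_sum_erase s _ hi, Function.update_self] at this
    have h2 : ∑ j ∈ s.erase i, φ j (Function.update (fun _ => w₀) i w j) =
        ∑ j ∈ s.erase i, φ j w₀ :=
      Finset.sum_congr rfl fun j hj => by rw [Function.update_of_ne (Finset.ne_of_mem_erase hj)]
    linarith
  refine ⟨fun i => sSup (φ i '' S), fun i hi w hw => le_csSup (hbdd i hi) ⟨w, hw, rfl⟩, ?_⟩
  refine le_of_forall_pos_le_add fun ε hε => ?_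
  have hδ : 0 < ε / (s.card + 1) := by positivity
  have happrox : ∀ i, ∃ w ∈ S, sSup (φ i '' S) - ε / (s.card + 1) < φ i w := by
    intro i
    obtain ⟨_, ⟨w, hw, rfl⟩, h⟩ := exists_lt_of_lt_csSup (s := φ i '' S) ⟨_, w₀, hw₀, rfl⟩
      (sub_lt_self _ hδ)
    exact ⟨w, hw, h⟩
  choose w hw hlt using happrox
  have h1 : ∑ i ∈ s, (sSup (φ i '' S) - ε / (s.card + 1)) ≤ B :=
    (Finset.sum_le_sum fun i _ => (hlt i).le).trans (hB w hw)
  rw [Finset.sum_sub_distrib, Finset.sum_const, nsmul_eq_mul] at h1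
  have h2 : (s.card : ℝ) * (ε / (s.card + 1)) ≤ ε := by
    rw [mul_div_assoc', div_le_iff₀ (by positivity)]
    nlinarith
  linarith

end Separation

/-! ### Transport plans and strong duality -/

section StrongDuality

variable {ι E : Type*} [NormedAddCommGroup E]

/-- The cost of moving mass `1 / |s|` from `d l` to `a l`, for every `l` in `s`. -/
def transportCost (s : Finset ι) (d a : ι → E) : ℝ :=
  (s.card : ℝ)⁻¹ * ∑ l ∈ s, ‖a l - d l‖

theorem transportCost_nonneg (s : Finset ι) (d a : ι → E) : 0 ≤ transportCost s d a := by
  unfold transportCost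
  positivity

theorem transportCost_self (s : Finset ι) (d : ι → E) : transportCost s d d = 0 := by
  simp [transportCost]

variable [NormedSpace ℝ E] [FiniteDimensional ℝ E] [MeasurableSpace E] [BorelSpace E]

theorem lintegral_empirical_pair {s : Finset ι} (hs : s.Nonempty) (d a : ι → E) :
    ∫⁻ p, ‖p.1 - p.2‖ₑ ∂(empirical s fun l => (a l, d l)) =
      ENNReal.ofReal (transportCost s d a) := by
  have hc : (0 : ℝ) < s.card := by exact_mod_cast hs.card_pos
  rw [lintegral_empirical, transportCost, ENNReal.ofReal_mul (by positivity),
    ENNReal.ofReal_inv_of_pos hc, ENNReal.ofReal_natCast,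
    ENNReal.ofReal_sum_of_nonneg fun _ _ => norm_nonneg _]
  simp only [ofReal_norm]

/-- Moving `d` to `a` with weight `1 - t` and to `b` with weight `t` is a transport plan from the
empirical distribution, so its cost bounds the Wasserstein distance. -/
theorem mixture_mem_wassersteinBall {s : Finset ι} (hs : s.Nonempty) {d a b : ι → E} {Ξ : Set E}
    (ha : ∀ l ∈ s, a l ∈ Ξ) (hb : ∀ l ∈ s, b l ∈ Ξ) {t : ℝ} (ht0 : 0 ≤ t) (ht1 : t ≤ 1) {r : ℝ}
    (hr : (1 - t) * transportCost s d a + t * transportCost s d b ≤ r) :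
    ENNReal.ofReal (1 - t) • empirical s a + ENNReal.ofReal t • empirical s b ∈
      wassersteinBall Ξ r (empirical s d) := by
  have hsum : ENNReal.ofReal (1 - t) + ENNReal.ofReal t = 1 := by
    rw [← ENNReal.ofReal_add (by linarith) ht0]
    simp
  have := isProbabilityMeasure_empirical hs a
  have := isProbabilityMeasure_empirical hs b
  refine ⟨⟨⟨by simp [hsum]⟩, ?_⟩, ?_⟩
  · rw [ae_add_measure_iff]
    exact ⟨Measure.ae_smul_measure (ae_empirical ha) _, Measure.ae_smul_measure (ae_empirical hb) _⟩
  · refine (iInf₂_le (ENNReal.ofReal (1 - t) • empirical s (fun l => (a l, d l)) +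
      ENNReal.ofReal t • empirical s (fun l => (b l, d l))) ⟨?_, ?_⟩).trans ?_
    · rw [lintegral_add_measure, lintegral_smul_measure, lintegral_smul_measure,
        lintegral_empirical_pair hs, lintegral_empirical_pair hs, smul_eq_mul, smul_eq_mul,
        ← ENNReal.ofReal_mul (by linarith), ← ENNReal.ofReal_mul ht0,
        ← ENNReal.ofReal_add (mul_nonneg (by linarith) (transportCost_nonneg _ _ _))
          (mul_nonneg ht0 (transportCost_nonneg _ _ _))]
      exact ENNReal.ofReal_le_ofReal hr
    · rw [Measure.map_add _ _ measurable_fst, Measure.map_smul, Measure.map_smul,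
        map_empirical _ _ measurable_fst, map_empirical _ _ measurable_fst]
      rfl
    · rw [Measure.map_add _ _ measurable_snd, Measure.map_smul, Measure.map_smul,
        map_empirical _ _ measurable_snd, map_empirical _ _ measurable_snd]
      change ENNReal.ofReal (1 - t) • empirical s d + ENNReal.ofReal t • empirical s d = _
      rw [← add_smul, hsum, one_smul]

theorem mixture_le_worstCase {s : Finset ι} (hs : s.Nonempty) {d a b : ι → E} {Ξ : Set E}
    {h : E → EReal} (ha : ∀ l ∈ s, a l ∈ Ξ) (hb : ∀ l ∈ s, b l ∈ Ξ)
    {t : ℝ} (ht0 : 0 ≤ t) (ht1 : t ≤ 1) {r : ℝ}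
    (hr : (1 - t) * transportCost s d a + t * transportCost s d b ≤ r) :
    ((1 - t : ℝ) : EReal) * expect (empirical s a) h + (t : EReal) * expect (empirical s b) h ≤
      worstCase (wassersteinBall Ξ r (empirical s d)) h := by
  have h1t : 0 ≤ 1 - t := by linarith
  refine le_trans (le_of_eq ?_) (le_iSup₂ (f := fun Q _ => expect Q h) _
    (mixture_mem_wassersteinBall hs ha hb ht0 ht1 hr))
  have h1 : ∀ {c : ℝ} (μ : Measure E), 0 ≤ c →
      expect (ENNReal.ofReal c • μ) h = (c : EReal) * expect μ h := fun μ hc => by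
    rw [expect_smul ENNReal.ofReal_ne_top, ENNReal.toReal_ofReal hc]
  rw [expect_add, h1 _ h1t, h1 _ ht0]

/-- The empirical distribution itself is in the ball. -/
theorem worstCase_ne_bot {s : Finset ι} (hs : s.Nonempty) {d : ι → E} {Ξ : Set E} {h : E → EReal}
    (hd : ∀ l ∈ s, d l ∈ Ξ ∧ h (d l) ≠ ⊥) {r : ℝ} (hr : 0 ≤ r) :
    worstCase (wassersteinBall Ξ r (empirical s d)) h ≠ ⊥ := by
  refine ne_bot_of_le_ne_bot ?_ (mixture_le_worstCase hs
    (fun l hl => (hd l hl).1) (fun l hl => (hd l hl).1) le_rfl zero_le_one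
    (by simpa [transportCost_self] using hr))
  simpa using expect_empirical_ne_bot s fun l hl => (hd l hl).2

/-- A point of `Ξ` where `h` is `⊤` makes the worst case `⊤`, since the radius is positive and a
small amount of mass can be moved there. -/
theorem worstCase_eq_top {s : Finset ι} (hs : s.Nonempty) {d : ι → E} {Ξ : Set E} {h : E → EReal}
    (hd : ∀ l ∈ s, d l ∈ Ξ ∧ h (d l) ≠ ⊥) {r : ℝ} (hr : 0 < r) {w : E} (hw : w ∈ Ξ)
    (hwt : h w = ⊤) :
    worstCase (wassersteinBall Ξ r (empirical s d)) h = ⊤ := by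
  classical
  obtain ⟨i, hi⟩ := id hs
  set b := Function.update d i w with hbdef
  have hb : ∀ l ∈ s, b l ∈ Ξ ∧ h (b l) ≠ ⊥ := by
    intro l hl
    rcases eq_or_ne l i with rfl | hli
    · simp [hbdef, hw, hwt]
    · simpa [hbdef, hli] using hd l hl
  have hC := transportCost_nonneg s d b
  -- the weight `t = r / (r + C)` of the plan `b` with cost `C` keeps the cost `t * C` below `r`
  have hpos : 0 < r / (r + transportCost s d b) := by positivity
  have hle : r / (r + transportCost s d b) ≤ 1 := (div_le_one (by positivity)).2 (by linarith)
  have hmix := mixture_le_worstCase hs (d := d) (r := r) (h := h) (fun l hl => (hd l hl).1)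
    (fun l hl => (hb l hl).1) hpos.le hle (by
    rw [transportCost_self, mul_zero, zero_add, div_mul_eq_mul_div, div_le_iff₀ (by positivity)]
    nlinarith)
  rw [expect_empirical_eq_top (fun l hl => (hb l hl).2) hi (by simp [hbdef, hwt]),
    EReal.coe_mul_top_of_pos hpos, EReal.add_top_of_ne_bot] at hmix
  · exact top_le_iff.1 hmix
  · exact coe_mul_ne_bot (by linarith) (expect_empirical_ne_bot s fun l hl => (hd l hl).2)

/-- Strong duality with dual attainment: if the worst-case expectation over the ball is not `⊤`,
then there are feasible multipliers whose dual value does not exceed it. -/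
theorem exists_multiplier {s : Finset ι} (hs : s.Nonempty) {d : ι → E} {Ξ : Set E} {h : E → EReal}
    (hd : ∀ l ∈ s, d l ∈ Ξ ∧ h (d l) ≠ ⊥) {r : ℝ} (hr : 0 < r)
    (htop : worstCase (wassersteinBall Ξ r (empirical s d)) h ≠ ⊤) :
    ∃ (lam : ℝ) (α : ι → ℝ), 0 ≤ lam ∧
      (∀ l ∈ s, ∀ w ∈ Ξ, h w ≤ ((lam * ‖d l - w‖ + α l : ℝ) : EReal)) ∧
      ((lam * r + (s.card : ℝ)⁻¹ * ∑ l ∈ s, α l : ℝ) : EReal) ≤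
        worstCase (wassersteinBall Ξ r (empirical s d)) h := by
  have hfin : ∀ w ∈ Ξ, h w ≠ ⊤ := fun w hw hwt => htop (worstCase_eq_top hs hd hr hw hwt)
  have hbot := worstCase_ne_bot hs hd hr.le
  obtain ⟨v, hv⟩ : ∃ v : ℝ, (v : EReal) = worstCase (wassersteinBall Ξ r (empirical s d)) h :=
    ⟨_, EReal.coe_toReal htop hbot⟩
  set S : Set E := {w | w ∈ Ξ ∧ h w ≠ ⊥} with hS
  obtain ⟨i₀, hi₀⟩ := id hs
  have hc : (0 : ℝ) < s.card := by exact_mod_cast hs.card_pos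
  -- each `a` relocates every data point `d l` to `a l`; `d` itself has cost `0 < r`
  obtain ⟨lam, hlam, hsep⟩ := exists_slope (A := {a : ι → E // ∀ l ∈ s, a l ∈ S})
    (C := fun a => transportCost s d a)
    (G := fun a => (s.card : ℝ)⁻¹ * ∑ l ∈ s, (h (a.1 l)).toReal) (v := v) (r := r)
    (a₀ := ⟨d, hd⟩) (by simpa [transportCost_self] using hr) (by
      intro a b t ht0 ht1 hcost
      have := mixture_le_worstCase hs (h := h) (fun l hl => (a.2 l hl).1)
        (fun l hl => (b.2 l hl).1) ht0 ht1 hcost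
      rw [expect_empirical_coe s (fun l hl => (a.2 l hl).2) (fun l hl => hfin _ (a.2 l hl).1),
        expect_empirical_coe s (fun l hl => (b.2 l hl).2) (fun l hl => hfin _ (b.2 l hl).1),
        ← hv] at this
      exact_mod_cast this)
  -- the bound separates over the indices, so the supremum can be taken in each one independently
  obtain ⟨α, hα, hsum⟩ := exists_upperBounds_sum_le s (S := S) ⟨d i₀, hd i₀ hi₀⟩
    (φ := fun l w => (h w).toReal - lam * ‖w - d l‖) (B := s.card * (v - lam * r)) (by
      intro w hw
      have := hsep ⟨w, fun l _ => hw l⟩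
      simp only [transportCost] at this
      rw [Finset.sum_sub_distrib, ← Finset.mul_sum]
      have h2 : (s.card : ℝ) * ((s.card : ℝ)⁻¹ * ∑ l ∈ s, (h (w l)).toReal) ≤
          s.card * (v + lam * ((s.card : ℝ)⁻¹ * ∑ l ∈ s, ‖w l - d l‖ - r)) := by gcongr
      rw [mul_inv_cancel_left₀ hc.ne'] at h2
      have h3 : (s.card : ℝ) * (v + lam * ((s.card : ℝ)⁻¹ * ∑ l ∈ s, ‖w l - d l‖ - r)) =
          s.card * (v - lam * r) + lam * ∑ l ∈ s, ‖w l - d l‖ := by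
        field_simp
        ring
      linarith)
  refine ⟨lam, α, hlam, fun l hl w hw => ?_, ?_⟩
  · by_cases hwb : h w = ⊥
    · simp [hwb]
    rw [← EReal.coe_toReal (hfin w hw) hwb, EReal.coe_le_coe_iff, norm_sub_rev]
    linarith [hα l hl w ⟨hw, hwb⟩]
  · rw [← hv, EReal.coe_le_coe_iff]
    have h2 : (s.card : ℝ)⁻¹ * ∑ l ∈ s, α l ≤ (s.card : ℝ)⁻¹ * (s.card * (v - lam * r)) := by
      gcongr
    rw [inv_mul_cancel_left₀ hc.ne'] at h2
    linarith

end StrongDuality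

/-! ### Worst-case expectations over Minkowski sums -/

section MinkowskiSum

/-- A positively weighted sum of extended reals is the supremum of the sums with smaller entries. -/
theorem sum_coe_mul_le_of_forall_lt {κ : Type*} (s : Finset κ) {c : κ → ℝ} (hc : ∀ k, 0 < c k)
    {V : κ → EReal} {M : EReal}
    (H : ∀ y : κ → EReal, (∀ k ∈ s, y k < V k) → ∑ k ∈ s, (c k : EReal) * y k ≤ M) :
    ∑ k ∈ s, (c k : EReal) * V k ≤ M := by
  classical
  induction s using Finset.induction_on generalizing M with
  | empty => simpa using H 0 (by simp)
  | insert i s hi ih =>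
    rw [Finset.sum_insert hi]
    refine EReal.add_le_of_forall_lt fun a ha b hb => ?_
    obtain ⟨y, hy, hby⟩ : ∃ y : κ → EReal, (∀ k ∈ s, y k < V k) ∧
        b < ∑ k ∈ s, (c k : EReal) * y k := by
      by_contra! hcon
      exact (ih hcon).not_gt hb
    have hci : (0 : EReal) < c i := by exact_mod_cast hc i
    have hai : (c i : EReal) * (a / c i) = a :=
      EReal.mul_div_cancel (EReal.coe_ne_bot _) (EReal.coe_ne_top _) hci.ne'
    have := H (Function.update y i (a / c i)) (fun k hk => by
      rcases eq_or_ne k i with rfl | hki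
      · rw [Function.update_self, EReal.div_lt_iff hci (EReal.coe_ne_top _), mul_comm]
        exact ha
      · rw [Function.update_of_ne hki]
        exact hy k (Finset.mem_of_mem_insert_of_ne hk hki))
    rw [Finset.sum_insert hi, Function.update_self, hai, Finset.sum_congr rfl fun k hk => by
      rw [Function.update_of_ne (ne_of_mem_of_not_mem hk hi)]] at this
    exact (add_le_add_right hby.le a).trans this

variable {κ E : Type*} [Fintype κ] [MeasurableSpace E]

/-- The worst case over a weighted Minkowski sum splits, by additivity of the expectation in the
measure. This includes infinite worst cases and empty sets. -/
theorem worstCase_sum_smul {c : κ → ℝ≥0∞} (hc0 : ∀ k, c k ≠ 0) (hc : ∀ k, c k ≠ ⊤)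
    (W : κ → Set (Measure E)) (h : E → EReal) :
    worstCase (∑ k, c k • W k) h = ∑ k, ((c k).toReal : EReal) * worstCase (W k) h := by
  apply le_antisymm
  · refine iSup₂_le fun Q hQ => ?_
    obtain ⟨q, hq, rfl⟩ := (Set.mem_fintype_sum _ _).1 hQ
    choose R hR hRq using hq
    obtain rfl : (fun k => c k • R k) = q := funext hRq
    rw [expect_sum_smul _ _ _ fun k _ => hc k]
    refine Finset.sum_le_sum fun k _ => ?_
    refine mul_le_mul_of_nonneg_left (le_iSup₂ (f := fun Q _ => expect Q h) _ (hR k)) ?_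
    exact_mod_cast ENNReal.toReal_nonneg
  · refine sum_coe_mul_le_of_forall_lt _ (fun k => ENNReal.toReal_pos (hc0 k) (hc k)) ?_
    intro y hy
    have : ∀ k, ∃ R ∈ W k, y k < expect R h := fun k => by
      simpa [worstCase, lt_iSup_iff] using hy k (Finset.mem_univ k)
    choose R hR hyR using this
    refine le_trans ?_ (le_iSup₂ (f := fun Q _ => expect Q h) (∑ k, c k • R k) ?_)
    · rw [expect_sum_smul _ _ _ fun k _ => hc k]
      refine Finset.sum_le_sum fun k _ => mul_le_mul_of_nonneg_left (hyR k).le ?_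
      exact_mod_cast ENNReal.toReal_nonneg
    · exact (Set.mem_fintype_sum _ _).2 ⟨_, fun k => Set.smul_mem_smul_set (hR k), rfl⟩

end MinkowskiSum

/-! ### Addition with `∞ - ∞ = ∞` -/

section MinAdd

theorem minAdd_coe (a : EReal) (b : ℝ) : minAdd a b = a + b := by
  induction a with
  | bot => simp [minAdd]
  | top => simp [minAdd]
  | coe a =>
    simp only [minAdd, ← EReal.coe_neg, ← EReal.coe_add]
    congr 1
    ring

theorem minAdd_top (a : EReal) : minAdd a ⊤ = ⊤ := by
  simp [minAdd]

end MinAdd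

/-! ### The reformulated problem -/

section Reformulation

variable {E : Type*} [NormedAddCommGroup E] {n N K : ℕ} {X : Set (Fin n → ℝ)} {Ξ : Set E}
    {f : (Fin n → ℝ) → EReal} {g : (Fin n → ℝ) → E → EReal} {data : Fin N → E}
    {z : Fin N → Fin K} {θ : Fin K → ℝ} {x : Fin n → ℝ}

theorem cluster_nonempty (hz : Function.Surjective z) (k : Fin K) : (cluster z k).Nonempty := by
  obtain ⟨l, hl⟩ := hz k
  exact ⟨l, by simp [cluster, hl]⟩

theorem weight_pos (hz : Function.Surjective z) (k : Fin K) :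
    0 < ((cluster z k).card : ℝ) / (N : ℝ) := by
  have hc : 0 < (cluster z k).card := (cluster_nonempty hz k).card_pos
  have hN : 0 < N := (hz k).choose.pos
  positivity

/-- The constraints of the reformulation without suprema and subtraction. -/
theorem mem_reformFeasible_iff {p : (Fin n → ℝ) × (Fin K → ℝ) × (Fin N → ℝ)} :
    p ∈ reformFeasible X Ξ g data z ↔ p.1 ∈ X ∧ (∀ k, 0 ≤ p.2.1 k) ∧ ∀ k, ∀ l ∈ cluster z k,
      ∀ w ∈ Ξ, g p.1 w ≤ ((p.2.1 k * ‖data l - w‖ + p.2.2 l : ℝ) : EReal) := by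
  simp only [reformFeasible, Set.mem_ofPred_eq, iSup_le_iff]
  have : ∀ (a : EReal) (b c : ℝ), a - (b : EReal) ≤ c ↔ a ≤ ((b + c : ℝ) : EReal) := fun a b c => by
    rw [EReal.sub_le_iff_le_add (Or.inl (EReal.coe_ne_bot _)) (Or.inl (EReal.coe_ne_top _)),
      EReal.coe_add, add_comm]
  simp only [this]

variable [MeasurableSpace E]

theorem worstCase_ambiguitySet (hz : Function.Surjective z) (h : E → EReal) :
    worstCase (ambiguitySet Ξ data z θ) h =
      ∑ k, ((((cluster z k).card : ℝ) / (N : ℝ) : ℝ) : EReal) *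
        worstCase (localBall Ξ data z θ k) h := by
  have hN : ∀ k : Fin K, N ≠ 0 := fun k => (hz k).choose.pos.ne'
  rw [ambiguitySet, worstCase_sum_smul]
  · simp
  · intro k
    simpa using (cluster_nonempty hz k).ne_empty
  · intro k
    exact ENNReal.div_ne_top (ENNReal.natCast_ne_top _) (by simpa using hN k)

variable [NormedSpace ℝ E] [FiniteDimensional ℝ E] [BorelSpace E]

theorem worstCase_le_of_feasible (hz : Function.Surjective z) (hθ : ∀ k, 0 < θ k)
    (hg : Measurable (g x)) {lam : Fin K → ℝ} {α : Fin N → ℝ}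
    (hp : (x, lam, α) ∈ reformFeasible X Ξ g data z) :
    worstCase (ambiguitySet Ξ data z θ) (g x) ≤
      ((∑ k, ((cluster z k).card : ℝ) / (N : ℝ) *
        (lam k * θ k + ∑ l ∈ cluster z k, α l / ((cluster z k).card : ℝ)) : ℝ) : EReal) := by
  obtain ⟨-, hlam, hα⟩ := mem_reformFeasible_iff.1 hp
  rw [worstCase_ambiguitySet hz, coe_finsetSum]
  refine Finset.sum_le_sum fun k _ => ?_
  rw [EReal.coe_mul]
  refine mul_le_mul_of_nonneg_left ?_ (by exact_mod_cast (weight_pos hz k).le)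
  rw [← Finset.sum_div, div_eq_inv_mul]
  exact worstCase_wassersteinBall_le (cluster_nonempty hz k) hg (hlam k) (hα k) (hθ k).le

theorem exists_feasible_le_worstCase (hx : x ∈ X) (hz : Function.Surjective z) (hθ : ∀ k, 0 < θ k)
    (hdata : ∀ l, data l ∈ Ξ) (hgd : ∀ l, g x (data l) ≠ ⊥)
    (htop : worstCase (ambiguitySet Ξ data z θ) (g x) ≠ ⊤) :
    ∃ (lam : Fin K → ℝ) (α : Fin N → ℝ), (x, lam, α) ∈ reformFeasible X Ξ g data z ∧
      ((∑ k, ((cluster z k).card : ℝ) / (N : ℝ) *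
        (lam k * θ k + ∑ l ∈ cluster z k, α l / ((cluster z k).card : ℝ)) : ℝ) : EReal) ≤
      worstCase (ambiguitySet Ξ data z θ) (g x) := by
  have hd : ∀ k, ∀ l ∈ cluster z k, data l ∈ Ξ ∧ g x (data l) ≠ ⊥ :=
    fun _ l _ => ⟨hdata l, hgd l⟩
  have hVbot : ∀ k, worstCase (localBall Ξ data z θ k) (g x) ≠ ⊥ := fun k =>
    worstCase_ne_bot (cluster_nonempty hz k) (hd k) (hθ k).le
  have hVtop : ∀ k, worstCase (localBall Ξ data z θ k) (g x) ≠ ⊤ := by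
    intro k hk
    apply htop
    rw [worstCase_ambiguitySet hz, ← Finset.add_sum_erase _ _ (Finset.mem_univ k), hk,
      EReal.coe_mul_top_of_pos (weight_pos hz k)]
    exact EReal.top_add_of_ne_bot <| sum_ne_bot fun j _ =>
      coe_mul_ne_bot (weight_pos hz j).le (hVbot j)
  choose lam α hlam hα hval using fun k =>
    exists_multiplier (cluster_nonempty hz k) (hd k) (hθ k) (hVtop k)
  have hαz : ∀ k, ∀ l ∈ cluster z k, α (z l) l = α k l := fun k l hl => by
    rw [(Finset.mem_filter.1 hl).2]
  refine ⟨lam, fun l => α (z l) l, mem_reformFeasible_iff.2 ⟨hx, hlam, fun k l hl w hw => ?_⟩, ?_⟩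
  · simpa only [hαz k l hl] using hα k l hl w hw
  · rw [worstCase_ambiguitySet hz, coe_finsetSum]
    refine Finset.sum_le_sum fun k _ => ?_
    rw [EReal.coe_mul]
    refine mul_le_mul_of_nonneg_left ?_ (by exact_mod_cast (weight_pos hz k).le)
    rw [← Finset.sum_div, div_eq_inv_mul, Finset.sum_congr rfl (hαz k)]
    exact hval k

theorem robustObjective_le_reformObjective (hz : Function.Surjective z) (hθ : ∀ k, 0 < θ k)
    (hg : Measurable (g x)) {lam : Fin K → ℝ} {α : Fin N → ℝ}
    (hp : (x, lam, α) ∈ reformFeasible X Ξ g data z) :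
    robustObjective Ξ f g data z θ x ≤ reformObjective f z θ (x, lam, α) := by
  rw [reformObjective, ← minAdd_coe, robustObjective, minAdd, minAdd, EReal.neg_le_neg_iff]
  gcongr
  exact EReal.neg_le_neg_iff.2 (worstCase_le_of_feasible hz hθ hg hp)

theorem exists_reformObjective_eq (hx : x ∈ X) (hz : Function.Surjective z) (hθ : ∀ k, 0 < θ k)
    (hg : Measurable (g x)) (hdata : ∀ l, data l ∈ Ξ) (hgd : ∀ l, g x (data l) ≠ ⊥)
    (htop : worstCase (ambiguitySet Ξ data z θ) (g x) ≠ ⊤) :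
    ∃ (lam : Fin K → ℝ) (α : Fin N → ℝ), (x, lam, α) ∈ reformFeasible X Ξ g data z ∧
      reformObjective f z θ (x, lam, α) = robustObjective Ξ f g data z θ x := by
  obtain ⟨lam, α, hp, hle⟩ := exists_feasible_le_worstCase hx hz hθ hdata hgd htop
  refine ⟨lam, α, hp, le_antisymm ?_ (robustObjective_le_reformObjective hz hθ hg hp)⟩
  rw [reformObjective, ← minAdd_coe, robustObjective, minAdd, minAdd, EReal.neg_le_neg_iff]
  gcongr
  exact EReal.neg_le_neg_iff.2 hle

end Reformulation

end BNWDRO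

end

/-! ### Equivalence of the two problems -/

open BNWDRO in
theorem theorem4 {E : Type*} [NormedAddCommGroup E] [NormedSpace ℝ E] [FiniteDimensional ℝ E]
    [MeasurableSpace E] [BorelSpace E] {n N K : ℕ}
    (X : Set (Fin n → ℝ)) (Ξ : Set E)
    (f : (Fin n → ℝ) → EReal) (g : (Fin n → ℝ) → E → EReal)
    (data : Fin N → E) (hdata : ∀ l, data l ∈ Ξ)
    (z : Fin N → Fin K) (hz : Function.Surjective z)
    (θ : Fin K → ℝ) (hθ : ∀ k, 0 < θ k)
    (hg : ∀ x ∈ X, Measurable (g x))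
    (hgdata : ∀ x ∈ X, ∀ l, g x (data l) ≠ ⊥) :
    -- the worst-case expectation splits over the local balls
    (∀ x ∈ X, worstCase (ambiguitySet Ξ data z θ) (g x) =
      ∑ k, ((((cluster z k).card : ℝ) / (N : ℝ) : ℝ) : EReal) *
        worstCase (localBall Ξ data z θ k) (g x)) ∧
    -- the two problems have the same optimal value
    (⨅ x ∈ X, robustObjective Ξ f g data z θ x) =
      (⨅ p ∈ reformFeasible X Ξ g data z, reformObjective f z θ p) ∧
    -- for each fixed decision, minimizing over the other variables gives the robust objective
    (∀ x ∈ X, robustObjective Ξ f g data z θ x =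
      ⨅ lam : Fin K → ℝ, ⨅ α : Fin N → ℝ, ⨅ _ : (x, lam, α) ∈ reformFeasible X Ξ g data z,
        reformObjective f z θ (x, lam, α)) ∧
    -- this inner minimum is attained when the worst-case expectation is not infinite
    (∀ x ∈ X, worstCase (ambiguitySet Ξ data z θ) (g x) < ⊤ →
      ∃ (lam : Fin K → ℝ) (α : Fin N → ℝ), (x, lam, α) ∈ reformFeasible X Ξ g data z ∧
        reformObjective f z θ (x, lam, α) = robustObjective Ξ f g data z θ x) ∧
    -- the two problems have the same optimal decisions
    (∀ x, (x ∈ X ∧ IsMinOn (robustObjective Ξ f g data z θ) X x ∧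
        robustObjective Ξ f g data z θ x < ⊤) ↔
      ∃ (lam : Fin K → ℝ) (α : Fin N → ℝ), (x, lam, α) ∈ reformFeasible X Ξ g data z ∧
        IsMinOn (reformObjective f z θ) (reformFeasible X Ξ g data z) (x, lam, α) ∧
        reformObjective f z θ (x, lam, α) < ⊤) := by
  have hle : ∀ x ∈ X, ∀ lam α, (x, lam, α) ∈ reformFeasible X Ξ g data z →
      robustObjective Ξ f g data z θ x ≤ reformObjective f z θ (x, lam, α) :=
    fun x hx _ _ hp => robustObjective_le_reformObjective hz hθ (hg x hx) hp
  have hattain : ∀ x ∈ X, worstCase (ambiguitySet Ξ data z θ) (g x) < ⊤ →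
      ∃ (lam : Fin K → ℝ) (α : Fin N → ℝ), (x, lam, α) ∈ reformFeasible X Ξ g data z ∧
        reformObjective f z θ (x, lam, α) = robustObjective Ξ f g data z θ x :=
    fun x hx h => exists_reformObjective_eq hx hz hθ (hg x hx) hdata (hgdata x hx) h.ne
  -- a worst case `⊤` makes the robust objective `⊤` whatever `f x` is, by definition of `minAdd`
  have hcase : ∀ x ∈ X, robustObjective Ξ f g data z θ x = ⊤ ∨
      ∃ (lam : Fin K → ℝ) (α : Fin N → ℝ), (x, lam, α) ∈ reformFeasible X Ξ g data z ∧
        reformObjective f z θ (x, lam, α) = robustObjective Ξ f g data z θ x := by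
    intro x hx
    rcases eq_or_ne (worstCase (ambiguitySet Ξ data z θ) (g x)) ⊤ with h | h
    · exact Or.inl (by rw [robustObjective, h, minAdd_top])
    · exact Or.inr (hattain x hx h.lt_top)
  refine ⟨fun x _ => worstCase_ambiguitySet hz _, ?_, fun x hx => ?_, hattain, fun x => ?_⟩
  · apply le_antisymm
    · exact le_iInf₂ fun p hp => (iInf₂_le p.1 hp.1).trans (hle p.1 hp.1 _ _ hp)
    · refine le_iInf₂ fun x hx => ?_
      rcases hcase x hx with h | ⟨lam, α, hp, h⟩
      · exact h ▸ le_top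
      · exact h ▸ iInf₂_le _ hp
  · apply le_antisymm
    · exact le_iInf fun lam => le_iInf₂ fun α hp => hle x hx lam α hp
    · rcases hcase x hx with h | ⟨lam, α, hp, h⟩
      · exact h ▸ le_top
      · rw [← h]
        exact (iInf_le _ lam).trans (iInf₂_le α hp)
  · constructor
    · rintro ⟨hx, hmin, hlt⟩
      rcases hcase x hx with h | ⟨lam, α, hp, h⟩
      · exact absurd h hlt.ne
      · refine ⟨lam, α, hp, isMinOn_iff.2 fun p hp' => ?_, h ▸ hlt⟩
        rw [h]
        exact (isMinOn_iff.1 hmin p.1 hp'.1).trans (hle p.1 hp'.1 _ _ hp')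
    · rintro ⟨lam, α, hp, hmin, hlt⟩
      have h1 := hle x hp.1 lam α hp
      refine ⟨hp.1, isMinOn_iff.2 fun y hy => h1.trans ?_, h1.trans_lt hlt⟩
      rcases hcase y hy with h | ⟨lam', α', hp', h⟩
      · exact h ▸ le_top
      · exact h ▸ isMinOn_iff.1 hmin _ hp'
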